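/- Let $n \ge 1$ and let $\mathfrak{B}_n$ be the hyperoctahedral group, i.e. the group under composition of all bijections $\pi$ of $\{-n,\ldots,-1,0,1,\ldots,n\}$ with $\pi(-i) = -\pi(i)$ for all $i$ (so $\pi(0)=0$). A peak of $\pi \in \mathfrak{B}_n$ is a position $i \in \{1,\ldots,n-1\}$ with $\pi(i-1) < \pi(i) > \pi(i+1)$. For $i \ge 0$ let $E_i^{+}$ (respectively $E_i^{-}$) denote the sum, in the group algebra $\mathbb{Q}[\mathfrak{B}_n]$, of all $\pi \in \mathfrak{B}_n$ with exactly $i$ peaks and $\pi(1) > 0$ (respectively $\pi(1) < 0$). Then the $\mathbb{Q}$-linear span $\mathfrak{p}_{B,n}$ of all the elements $E_i^{+}$ and $E_i^{-}$, $i \ge 0$, is a unital subalgebra of $\mathbb{Q}[\mathfrak{B}_n]$; it is commutative and has dimension $n+1$ over $\mathbb{Q}$. -/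

import Mathlib

/-- The set `±[n] = {-n, …, -1, 0, 1, …, n}`. -/
abbrev SignedInterval (n : ℕ) : Type := ↥(Finset.Icc (-(n : ℤ)) n)

/-- The involution `i ↦ -i` of `±[n]`. -/
def SignedInterval.neg {n : ℕ} (i : SignedInterval n) : SignedInterval n :=
  ⟨-i.1, by have h := Finset.mem_Icc.1 i.2; exact Finset.mem_Icc.2 (by omega)⟩

/-- The hyperoctahedral group `𝔅ₙ`: the bijections `π : ±[n] → ±[n]` with `π(-i) = -π(i)`,
under composition. -/
def SignedPerm (n : ℕ) : Subgroup (Equiv.Perm (SignedInterval n)) where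
  carrier := {π | ∀ i, π i.neg = (π i).neg}
  one_mem' := fun _ => rfl
  mul_mem' := by
    intro a b ha hb i
    change a (b i.neg) = (a (b i)).neg
    rw [hb, ha]
  inv_mem' := by
    intro a ha i
    apply a.injective
    rw [ha]
    simp

namespace SignedPerm

variable {n : ℕ}

noncomputable instance : Fintype (SignedPerm n) := Fintype.ofFinite _

/-- The integer `π(i)` for `-n ≤ i ≤ n` (and `0`, for other `i`, a value that is never used when `1 ≤ n`). -/
noncomputable def app (π : SignedPerm n) (i : ℤ) : ℤ :=
  if h : i ∈ Finset.Icc (-(n : ℤ)) n then ((π.1 ⟨i, h⟩ : SignedInterval n) : ℤ) else 0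

/-- The set of peaks: positions `i ∈ {1, …, n - 1}` with `π(i-1) < π(i) > π(i+1)`
(where `π(0) = 0`). -/
noncomputable def peakSet (π : SignedPerm n) : Finset ℤ :=
  {i ∈ Finset.Icc (1 : ℤ) ((n : ℤ) - 1) | app π (i - 1) < app π i ∧ app π (i + 1) < app π i}

/-- The number of peaks. -/
noncomputable def peakNumber (π : SignedPerm n) : ℕ := (peakSet π).card

end SignedPerm

/-- `Eᵢ⁺`: the sum in `ℚ[𝔅ₙ]` of all signed permutations with `i` peaks and `π(1) > 0`. -/
noncomputable def peakSumPos (n i : ℕ) : MonoidAlgebra ℚ (SignedPerm n) :=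
  ∑ π : SignedPerm n with SignedPerm.peakNumber π = i ∧ 0 < SignedPerm.app π 1,
    MonoidAlgebra.of ℚ (SignedPerm n) π

/-- `Eᵢ⁻`: the sum in `ℚ[𝔅ₙ]` of all signed permutations with `i` peaks and `π(1) < 0`. -/
noncomputable def peakSumNeg (n i : ℕ) : MonoidAlgebra ℚ (SignedPerm n) :=
  ∑ π : SignedPerm n with SignedPerm.peakNumber π = i ∧ SignedPerm.app π 1 < 0,
    MonoidAlgebra.of ℚ (SignedPerm n) π

/-- The linear span `𝔭_{B,n}` of the elements `Eᵢ⁺` and `Eᵢ⁻`. -/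
noncomputable def peakSpanB (n : ℕ) : Submodule ℚ (MonoidAlgebra ℚ (SignedPerm n)) :=
  Submodule.span ℚ (Set.range (peakSumPos n) ∪ Set.range (peakSumNeg n))

/-! Call an odd map `±[n] → ±[k]` a word. Sorting its positions by letter, with ties broken
increasingly at even letters and decreasingly at odd ones, gives a signed permutation `std w`; let
`stdSum n k` be the sum of these over all words.

Multiplication: pairs of words over `±[k]` and `±[l]` correspond bijectively, and compatibly with
`std`, to words over an alphabet of `(2k+1)(2l+1)` letters (`OddMap.std_comp`, `OddMap.stdSum_mul`).
Hence the sums `stdSum n k` are closed under products and commute.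

Counting: the coefficient of `π` in `stdSum n (2K)` is the number of chains `0 = a₀ ≤ ⋯ ≤ aₙ ≤ 2K`
in which an ascent of `π` allows equality only at even letters and a descent only at odd ones. Its
generating function in `K` is `2^j X^⌈j/2⌉ (1+X)^(n-j) / (1-X)^(n+1)`, where `j` is twice the number
of peaks, plus one if `π(1) < 0` (`chainSeries_spec`). For odd cutoffs the count would also depend
on the last step of `π`.

The `n+1` numerators are linearly independent, so the sums `stdSum n (2K)` span `peakSpanB n`; `K =
0` gives the unit. Every class `j ≤ n` is inhabited, whence the dimension. -/

@[simp] theorem SignedInterval.val_neg {n : ℕ} (i : SignedInterval n) : i.neg.1 = -i.1 := rfl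

@[simp] theorem SignedInterval.neg_neg {n : ℕ} (i : SignedInterval n) : i.neg.neg = i :=
  Subtype.ext (by simp)

theorem SignedInterval.neg_lt_neg {n : ℕ} {i j : SignedInterval n} (h : i < j) :
    j.neg < i.neg := by
  have h' : i.1 < j.1 := h
  change -j.1 < -i.1
  omega

theorem SignedInterval.bounds {n : ℕ} (i : SignedInterval n) : -(n : ℤ) ≤ i.1 ∧ i.1 ≤ n :=
  Finset.mem_Icc.1 i.2

/-! ### Words and their standardization -/

/-- Odd maps `±[n] → ±[k]`. -/
abbrev OddMap (n k : ℕ) : Type :=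
  {w : SignedInterval n → SignedInterval k // ∀ i, w i.neg = (w i).neg}

noncomputable instance (n k : ℕ) : Fintype (OddMap n k) := Fintype.ofFinite _

namespace OddMap

variable {n k l : ℕ}

/-- The integer value of an odd map. -/
def val (w : OddMap n k) (i : SignedInterval n) : ℤ := (w.1 i).1

theorem val_neg (w : OddMap n k) (i : SignedInterval n) : w.val i.neg = -w.val i := by
  simp [val, w.2 i]

theorem bounds (w : OddMap n k) (i : SignedInterval n) : -(k : ℤ) ≤ w.val i ∧ w.val i ≤ k :=
  (w.1 i).bounds

theorem ext_val {w v : OddMap n k} (h : ∀ i, w.val i = v.val i) : w = v :=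
  Subtype.ext (funext fun i => Subtype.ext (h i))

/-- An odd map from a bounded odd integer-valued function. -/
def ofFun (f : SignedInterval n → ℤ) (hf : ∀ i, f i.neg = -f i)
    (hb : ∀ i, -(k : ℤ) ≤ f i ∧ f i ≤ k) : OddMap n k :=
  ⟨fun i => ⟨f i, Finset.mem_Icc.2 (hb i)⟩, fun i => Subtype.ext (hf i)⟩

@[simp] theorem val_ofFun (f : SignedInterval n → ℤ) (hf : ∀ i, f i.neg = -f i)
    (hb : ∀ i, -(k : ℤ) ≤ f i ∧ f i ≤ k) (i : SignedInterval n) : (ofFun f hf hb).val i = f i :=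
  rfl

/-- The strict order on `±[n]` induced by a word `w`: compare letters first, and break ties
increasingly at even letters and decreasingly at odd letters. -/
def Prec (w : OddMap n k) (x y : SignedInterval n) : Prop :=
  w.val x < w.val y ∨ (w.val x = w.val y ∧
    ((Even (w.val x) ∧ x.1 < y.1) ∨ (¬ Even (w.val x) ∧ y.1 < x.1)))

/-- An integer key realising the order `Prec`. -/
def key (w : OddMap n k) (x : SignedInterval n) : ℤ :=
  (2 * n + 1) * w.val x + if Even (w.val x) then x.1 else -x.1

theorem key_neg (w : OddMap n k) (x : SignedInterval n) : w.key x.neg = -w.key x := by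
  unfold key
  rw [val_neg]
  simp only [even_neg, SignedInterval.val_neg]
  split_ifs <;> ring

/-- The tie-breaking terms lie in `[-n, n]`, so their difference never reaches the weight `2n + 1`.
-/
theorem key_lt_of_val_lt (w : OddMap n k) {x y : SignedInterval n} (h : w.val x < w.val y) :
    w.key x < w.key y := by
  have hx := x.bounds
  have hy := y.bounds
  have h2 : (2 * (n : ℤ) + 1) * (w.val x + 1) ≤ (2 * n + 1) * w.val y :=
    mul_le_mul_of_nonneg_left h (by omega)
  unfold key
  split_ifs <;> linarith

theorem prec_iff_key_lt (w : OddMap n k) (x y : SignedInterval n) :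
    w.Prec x y ↔ w.key x < w.key y := by
  rcases lt_trichotomy (w.val x) (w.val y) with h | h | h
  · simp [Prec, h, w.key_lt_of_val_lt h]
  · simp only [Prec, key, h]
    by_cases he : Even (w.val y)
    · simp [he]
    · simp only [he, lt_irrefl, false_and, not_false_eq_true, true_and, false_or, if_false]
      constructor <;> intro <;> linarith
  · simp [Prec, h.not_gt, h.ne', (w.key_lt_of_val_lt h).not_gt]

theorem key_injective (w : OddMap n k) : Function.Injective w.key := by
  intro x y h
  have hv : w.val x = w.val y := by
    rcases lt_trichotomy (w.val x) (w.val y) with h' | h' | h'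
    · exact absurd h (w.key_lt_of_val_lt h').ne
    · exact h'
    · exact absurd h (w.key_lt_of_val_lt h').ne'
  apply Subtype.ext
  simp only [key, hv] at h
  split_ifs at h <;> linarith

/-- `π` sorts the word `w`. -/
def Sorts (w : OddMap n k) (π : SignedPerm n) : Prop :=
  ∀ i j : SignedInterval n, i < j → w.Prec (π.1 i) (π.1 j)

theorem sorts_iff (w : OddMap n k) (π : SignedPerm n) :
    w.Sorts π ↔ StrictMono (fun i => w.key (π.1 i)) := by
  simp only [Sorts, prec_iff_key_lt]
  rfl

end OddMap

theorem exists_perm_strictMono {α : Type*} [Fintype α] [LinearOrder α] (f : α → ℤ)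
    (hf : Function.Injective f) : ∃ π : Equiv.Perm α, StrictMono (fun i => f (π i)) := by
  classical
  have hc : (Finset.univ.image f).card = Fintype.card α := Finset.card_image_of_injective _ hf
  let e₁ : Fin (Fintype.card α) ≃o α := Fintype.orderIsoFinOfCardEq α rfl
  let e₂ := (Finset.univ.image f).orderEmbOfFin hc
  have hmem : ∀ i, ∃ a, f a = e₂ i := fun i => by
    obtain ⟨a, -, ha⟩ := Finset.mem_image.1 ((Finset.univ.image f).orderEmbOfFin_mem hc i)
    exact ⟨a, ha⟩
  choose g hg using hmem
  have hinj : Function.Injective (fun a => g (e₁.symm a)) := by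
    intro a b h
    have := congrArg f h
    simp only [hg] at this
    exact e₁.symm.injective (e₂.injective this)
  refine ⟨Equiv.ofBijective _ (Finite.injective_iff_bijective.1 hinj), fun a b h => ?_⟩
  simpa [hg] using h

theorem perm_eq_of_strictMono {α : Type*} [Fintype α] [LinearOrder α] {f : α → ℤ}
    (hf : Function.Injective f) {π σ : Equiv.Perm α} (hπ : StrictMono (fun i => f (π i)))
    (hσ : StrictMono (fun i => f (σ i))) : π = σ := by
  have h : (fun i => f (π i)) = fun i => f (σ i) := by
    refine (StrictMono.range_inj hπ hσ).1 ?_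
    change Set.range (f ∘ π) = Set.range (f ∘ σ)
    rw [π.surjective.range_comp, σ.surjective.range_comp]
  exact Equiv.ext fun i => hf (congrFun h i)

namespace OddMap

variable {n k l : ℕ}

theorem existsUnique_sorts (w : OddMap n k) : ∃! π : SignedPerm n, w.Sorts π := by
  obtain ⟨π, hπ⟩ := exists_perm_strictMono w.key w.key_injective
  let ν : Equiv.Perm (SignedInterval n) :=
    ⟨SignedInterval.neg, SignedInterval.neg, SignedInterval.neg_neg, SignedInterval.neg_neg⟩
  -- The key is odd, so conjugating the sorting bijection by negation sorts again; uniqueness then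
  -- makes it odd.
  have hodd : ν * π * ν = π := by
    refine perm_eq_of_strictMono w.key_injective (fun i j h => ?_) hπ
    change w.key (π i.neg).neg < w.key (π j.neg).neg
    rw [key_neg, key_neg]
    exact neg_lt_neg (hπ (SignedInterval.neg_lt_neg h))
  refine ⟨⟨π, fun i => ?_⟩, (w.sorts_iff _).2 hπ, fun σ hσ => Subtype.ext ?_⟩
  · conv_lhs => rw [← hodd]
    change (π i.neg.neg).neg = _
    rw [SignedInterval.neg_neg]
  · exact perm_eq_of_strictMono w.key_injective ((w.sorts_iff _).1 hσ) hπ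

/-- The standardization of `w`: the signed permutation that sorts `w`. -/
noncomputable def std (w : OddMap n k) : SignedPerm n := w.existsUnique_sorts.choose

theorem sorts_std (w : OddMap n k) : w.Sorts w.std := w.existsUnique_sorts.choose_spec.1

theorem std_eq_iff (w : OddMap n k) (π : SignedPerm n) : w.std = π ↔ w.Sorts π :=
  ⟨fun h => h ▸ w.sorts_std, fun h => w.existsUnique_sorts.unique w.sorts_std h⟩

/-! ### Products of standardizations -/

/-- Uniqueness of division by `2k + 1` with balanced remainder; it decodes the letters of `comp`. -/
theorem balanced_unique {k : ℕ} {a b c d : ℤ} (hb : -(k : ℤ) ≤ b ∧ b ≤ k)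
    (hd : -(k : ℤ) ≤ d ∧ d ≤ k) (h : (2 * k + 1) * a + b = (2 * k + 1) * c + d) :
    a = c ∧ b = d := by
  have hac : a = c := by
    rcases lt_trichotomy a c with h' | h' | h'
    · have : (2 * (k : ℤ) + 1) * (a + 1) ≤ (2 * k + 1) * c :=
        mul_le_mul_of_nonneg_left h' (by omega)
      linarith
    · exact h'
    · have : (2 * (k : ℤ) + 1) * (c + 1) ≤ (2 * k + 1) * a :=
        mul_le_mul_of_nonneg_left h' (by omega)
      linarith
  subst hac
  exact ⟨rfl, by linarith⟩

theorem inv_apply_neg (σ : SignedPerm n) (x : SignedInterval n) :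
    σ⁻¹.1 x.neg = (σ⁻¹.1 x).neg := σ⁻¹.2 x

/-- Composition of words; its letters are pairs of letters in a signed lexicographic order. -/
noncomputable def comp (u : OddMap n k) (v : OddMap n l) : OddMap n (2 * k * l + k + l) :=
  ofFun (fun x => (2 * k + 1) * v.val (u.std⁻¹.1 x) +
      if Even (v.val (u.std⁻¹.1 x)) then u.val x else -u.val x)
    (fun x => by
      simp only [inv_apply_neg, val_neg, even_neg]
      split_ifs <;> ring)
    (fun x => by
      have hu := u.bounds x
      generalize u.std⁻¹.1 x = y
      have hv := v.bounds y
      have h1 : (2 * (k : ℤ) + 1) * v.val y ≤ (2 * k + 1) * l :=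
        mul_le_mul_of_nonneg_left hv.2 (by omega)
      have h2 : (2 * (k : ℤ) + 1) * (-l) ≤ (2 * k + 1) * v.val y :=
        mul_le_mul_of_nonneg_left hv.1 (by omega)
      push_cast
      split_ifs <;> constructor <;> linarith)

theorem val_comp_apply (u : OddMap n k) (v : OddMap n l) (y : SignedInterval n) :
    (u.comp v).val (u.std.1 y) = (2 * k + 1) * v.val y +
      if Even (v.val y) then u.val (u.std.1 y) else -u.val (u.std.1 y) := by
  have : u.std⁻¹.1 (u.std.1 y) = y := Equiv.symm_apply_apply u.std.1 y
  simp only [comp, val_ofFun, this]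

theorem even_val_comp_apply (u : OddMap n k) (v : OddMap n l) (y : SignedInterval n) :
    Even ((u.comp v).val (u.std.1 y)) ↔ (Even (v.val y) ↔ Even (u.val (u.std.1 y))) := by
  have hk : ¬ Even (2 * (k : ℤ) + 1) := by simp
  rw [val_comp_apply, Int.even_add, Int.even_mul]
  split_ifs <;> simp_all

/-- The leading digit, the letter of `v`, decides unless there is a tie. At an even tie the low
digit is the letter of `u` and has the parity of the whole letter. At an odd tie `v` reverses
positions, which is matched by negating the low digit; the parity flips too, since `2k + 1` is odd,
so the ties of `u` are also reversed. -/
theorem std_comp (u : OddMap n k) (v : OddMap n l) : (u.comp v).std = u.std * v.std := by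
  rw [std_eq_iff]
  intro i j hij
  have hv := v.sorts_std i j hij
  change (u.comp v).Prec (u.std.1 (v.std.1 i)) (u.std.1 (v.std.1 j))
  generalize v.std.1 i = x at hv ⊢
  generalize v.std.1 j = y at hv ⊢
  unfold Prec
  rw [even_val_comp_apply]
  rcases hv with h | ⟨h, ⟨he, hxy⟩ | ⟨he, hxy⟩⟩
  · left
    have h2 : (2 * (k : ℤ) + 1) * (v.val x + 1) ≤ (2 * k + 1) * v.val y :=
      mul_le_mul_of_nonneg_left h (by omega)
    have hx := u.bounds (u.std.1 x)
    have hy := u.bounds (u.std.1 y)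
    rw [val_comp_apply, val_comp_apply]
    split_ifs <;> linarith
  · have hu := u.sorts_std x y hxy
    rw [val_comp_apply, val_comp_apply, ← h, if_pos he, if_pos he]
    unfold Prec at hu
    simpa [he] using hu
  · have hu := u.sorts_std y x hxy
    rw [val_comp_apply, val_comp_apply, ← h, if_neg he, if_neg he]
    unfold Prec at hu
    rcases hu with hu | ⟨hu, hu'⟩
    · left; linarith
    · right
      rw [hu] at hu' ⊢
      refine ⟨rfl, ?_⟩
      simp only [he, false_iff, not_not]
      tauto

theorem comp_injective :
    Function.Injective (fun p : OddMap n k × OddMap n l => p.1.comp p.2) := by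
  rintro ⟨u, v⟩ ⟨u', v'⟩ h
  have key : ∀ x, v.val (u.std⁻¹.1 x) = v'.val (u'.std⁻¹.1 x) ∧ u.val x = u'.val x := by
    intro x
    have hx : (u.comp v).val x = (u'.comp v').val x := by
      exact congrArg (fun w => OddMap.val w x) h
    simp only [comp, val_ofFun] at hx
    have hu := u.bounds x
    have hu' := u'.bounds x
    obtain ⟨h1, h2⟩ := balanced_unique (by split_ifs <;> omega) (by split_ifs <;> omega) hx
    refine ⟨h1, ?_⟩
    rw [h1] at h2
    split_ifs at h2 <;> linarith
  have huu : u = u' := ext_val fun x => (key x).2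
  subst huu
  refine Prod.ext rfl (ext_val fun y => ?_)
  have := (key (u.std.1 y)).1
  rwa [show u.std⁻¹.1 (u.std.1 y) = y from Equiv.symm_apply_apply u.std.1 y] at this

theorem comp_surjective :
    Function.Surjective (fun p : OddMap n k × OddMap n l => p.1.comp p.2) := by
  intro W
  have hpos : (0 : ℤ) < 2 * k + 1 := by omega
  -- Adding `k` before dividing puts the remainder in `[-k, k]`; a balanced remainder is what makes
  -- both digits odd functions.
  let b : SignedInterval n → ℤ := fun x => (W.val x + k) / (2 * k + 1)
  let e : SignedInterval n → ℤ := fun x => W.val x - (2 * k + 1) * b x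
  have heq : ∀ x, (2 * k + 1) * b x + e x = W.val x := fun x => by simp only [e]; ring
  have he : ∀ x, -(k : ℤ) ≤ e x ∧ e x ≤ k := fun x => by
    have h1 := Int.emod_add_mul_ediv (W.val x + k) (2 * k + 1)
    have h2 := Int.emod_nonneg (W.val x + k) hpos.ne'
    have h3 := Int.emod_lt_of_pos (W.val x + k) hpos
    simp only [e, b]
    constructor <;> linarith
  have hodd : ∀ x, b x.neg = -b x ∧ e x.neg = -e x := fun x => by
    have hx := he x
    refine balanced_unique (he x.neg) (by omega) ?_
    rw [heq, val_neg, ← heq]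
    ring
  have hb : ∀ x, -(l : ℤ) ≤ b x ∧ b x ≤ l := fun x => by
    have hW := W.bounds x
    have hx := he x
    have hq := heq x
    push_cast at hW
    constructor
    · by_contra! hlt
      have : (2 * (k : ℤ) + 1) * (b x + 1) ≤ (2 * k + 1) * (-l) :=
        mul_le_mul_of_nonneg_left hlt hpos.le
      linarith
    · by_contra! hlt
      have : (2 * (k : ℤ) + 1) * (l + 1) ≤ (2 * k + 1) * b x :=
        mul_le_mul_of_nonneg_left hlt hpos.le
      linarith
  let u : OddMap n k := ofFun (fun x => if Even (b x) then e x else -e x)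
    (fun x => by
      simp only [(hodd x).1, (hodd x).2, even_neg]
      split_ifs <;> rfl)
    (fun x => by have := he x; split_ifs <;> omega)
  let v : OddMap n l := ofFun (fun y => b (u.std.1 y))
    (fun y => by rw [u.std.2, (hodd _).1]) (fun y => hb _)
  refine ⟨(u, v), ext_val fun x => ?_⟩
  have hx : u.std.1 (u.std⁻¹.1 x) = x := Equiv.apply_symm_apply u.std.1 x
  simp only [comp, val_ofFun, v, hx]
  rw [← heq x]
  congr 1
  simp only [u, val_ofFun]
  split_ifs <;> simp

/-- The sum of the standardizations of all words with letters in `±[k]`. -/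
noncomputable def stdSum (n k : ℕ) : MonoidAlgebra ℚ (SignedPerm n) :=
  ∑ w : OddMap n k, MonoidAlgebra.of ℚ (SignedPerm n) w.std

/-- The new cutoff comes from `(2k+1)(2l+1) = 2(2kl+k+l) + 1`. -/
theorem stdSum_mul (n k l : ℕ) : stdSum n k * stdSum n l = stdSum n (2 * k * l + k + l) := by
  unfold stdSum
  rw [Finset.sum_mul_sum, ← Finset.sum_product']
  refine Fintype.sum_bijective (fun p : OddMap n k × OddMap n l => p.1.comp p.2)
    ⟨comp_injective, comp_surjective⟩ _ _ fun p => ?_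
  rw [std_comp, map_mul]

/-- The only word is zero; its ties, at an even letter, are broken increasingly, so the identity
sorts it. -/
theorem stdSum_zero (n : ℕ) : stdSum n 0 = 1 := by
  have hv : ∀ (w : OddMap n 0) i, w.val i = 0 := fun w i => by
    have := w.bounds i
    push_cast at this
    omega
  have : Unique (OddMap n 0) :=
    { default := ofFun (fun _ => 0) (fun _ => by simp) (fun _ => by simp)
      uniq := fun w => ext_val fun i => by rw [hv, hv] }
  unfold stdSum
  rw [Fintype.sum_unique, (std_eq_iff _ 1).2, map_one]
  intro i j hij
  right
  rw [hv, hv]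
  exact ⟨rfl, Or.inl ⟨by simp, hij⟩⟩

end OddMap


/-! ### Chains of letters -/

/-- One step of a chain of letters: the letter increases, or it stays the same and its parity
agrees with the direction of the step (`D` means descent). -/
def ChainStep (D : Prop) (b c : ℕ) : Prop := b < c ∨ (b = c ∧ (Odd c ↔ D))

theorem ChainStep.le {D : Prop} {b c : ℕ} (h : ChainStep D b c) : b ≤ c := by
  rcases h with h | h
  · exact h.le
  · exact h.1.le

open Classical in
/-- The chains of letters `0 = a₀ ≤ ⋯ ≤ aᵢ = c` that follow the directions `d`, continued
constantly. -/
noncomputable def chains (d : ℕ → Prop) : ℕ → ℕ → Finset (ℕ → ℕ)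
  | 0, c => if c = 0 then {fun _ => 0} else ∅
  | i + 1, c => ((Finset.range (c + 1)).filter fun b => ChainStep (d i) b c).biUnion fun b =>
      (chains d i b).image fun a m => if m ≤ i then a m else c

theorem mem_chains (d : ℕ → Prop) (i c : ℕ) (a : ℕ → ℕ) :
    a ∈ chains d i c ↔
      a 0 = 0 ∧ (∀ m < i, ChainStep (d m) (a m) (a (m + 1))) ∧ ∀ m, i ≤ m → a m = c := by
  induction i generalizing c a with
  | zero =>
    simp only [chains]
    split_ifs with h
    · subst h
      simp only [Finset.mem_singleton, funext_iff]
      simp +contextual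
    · simp only [Finset.notMem_empty, false_iff, not_and]
      intro h0 _ h1
      exact h ((h1 0 le_rfl).symm.trans h0)
  | succ i ih =>
    simp only [chains, Finset.mem_biUnion, Finset.mem_filter, Finset.mem_range, Finset.mem_image,
      ih]
    constructor
    · rintro ⟨b, ⟨-, hs⟩, a, ⟨h0, h1, h2⟩, rfl⟩
      refine ⟨by simpa using h0, fun m hm => ?_, fun m hm => if_neg (by omega)⟩
      rcases Nat.lt_succ_iff_lt_or_eq.1 hm with h | rfl
      · simpa [h.le, Nat.succ_le_of_lt h] using h1 m h
      · simpa [h2 m le_rfl] using hs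
    · rintro ⟨h0, h1, h2⟩
      have hs := h1 i (by omega)
      rw [h2 (i + 1) le_rfl] at hs
      refine ⟨a i, ⟨Nat.lt_succ_of_le hs.le, hs⟩, fun m => a (min m i), ⟨by simpa using h0,
        fun m hm => ?_, fun m hm => by simp [hm]⟩, funext fun m => ?_⟩
      · have := h1 m (by omega)
        simpa [hm.le, Nat.succ_le_of_lt hm] using this
      · split_ifs with h
        · simp [h]
        · exact (h2 m (by omega)).symm

open Classical in
theorem card_chains_succ (d : ℕ → Prop) (i c : ℕ) :
    (chains d (i + 1) c).card = ∑ b ∈ Finset.range c, (chains d i b).card +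
      if (Odd c ↔ d i) then (chains d i c).card else 0 := by
  have hcard : ∀ b, ((chains d i b).image fun a m => if m ≤ i then a m else c).card =
      (chains d i b).card := by
    intro b
    refine Finset.card_image_of_injOn fun a ha a' ha' h => funext fun m => ?_
    have ha := ((mem_chains ..).1 ha).2.2
    have ha' := ((mem_chains ..).1 ha').2.2
    rcases le_total m i with hm | hm
    · simpa [hm] using congrFun h m
    · rw [ha m hm, ha' m hm]
  rw [chains, Finset.card_biUnion]
  · simp only [hcard, Finset.sum_filter, Finset.sum_range_succ]
    congr 1
    · exact Finset.sum_congr rfl fun b hb => if_pos (Or.inl (Finset.mem_range.1 hb))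
    · simp [ChainStep]
  · intro b _ b' _ hbb
    refine Finset.disjoint_left.2 fun a ha ha' => hbb ?_
    obtain ⟨x, hx, rfl⟩ := Finset.mem_image.1 ha
    obtain ⟨y, hy, hxy⟩ := Finset.mem_image.1 ha'
    have h := congrFun hxy i
    simp only [le_refl, if_true] at h
    rw [((mem_chains ..).1 hx).2.2 i le_rfl, ((mem_chains ..).1 hy).2.2 i le_rfl] at h
    exact h.symm

theorem card_chains_zero (d : ℕ → Prop) (c : ℕ) :
    (chains d 0 c).card = if c = 0 then 1 else 0 := by
  simp only [chains]
  split_ifs <;> rfl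

/-! ### Fibres of standardization as chains -/

/-- The point `min m n` of `±[n]`. -/
def SignedInterval.natPt (n m : ℕ) : SignedInterval n :=
  ⟨(min m n : ℕ), Finset.mem_Icc.2 (by omega)⟩

open SignedInterval (natPt)

theorem SignedInterval.val_natPt {n m : ℕ} (h : m ≤ n) : (natPt n m).1 = m := by
  simp [natPt, h]

theorem SignedInterval.eq_natPt {n : ℕ} (x : SignedInterval n) (h : 0 ≤ x.1) :
    x = natPt n x.1.natAbs :=
  Subtype.ext (by have := x.bounds; rw [val_natPt (by omega)]; omega)

theorem SignedInterval.eq_neg_natPt {n : ℕ} (x : SignedInterval n) (h : x.1 ≤ 0) :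
    x = (natPt n x.1.natAbs).neg :=
  Subtype.ext (by have := x.bounds; rw [val_neg, val_natPt (by omega)]; omega)

theorem SignedInterval.neg_natPt_zero (n : ℕ) : (natPt n 0).neg = natPt n 0 :=
  Subtype.ext (by simp [natPt])

theorem SignedInterval.natPt_lt {n m m' : ℕ} (h : m < m') (h' : m' ≤ n) :
    natPt n m < natPt n m' := by
  change (natPt n m).1 < (natPt n m').1
  rw [val_natPt (h.le.trans h'), val_natPt h']
  exact_mod_cast h

/-- Oddness gives `g 0 = 0` and reflects the nonnegative half onto the other one. -/
theorem SignedInterval.strictMono_of_odd {n : ℕ} {g : SignedInterval n → ℤ}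
    (hodd : ∀ x, g x.neg = -g x) (h : ∀ m < n, g (natPt n m) < g (natPt n (m + 1))) :
    StrictMono g := by
  have hlt : ∀ m m', m < m' → m' ≤ n → g (natPt n m) < g (natPt n m') := by
    intro m m' hm
    induction m', hm using Nat.le_induction with
    | base => exact fun hn => h m hn
    | succ k hk ih => exact fun hn => (ih (by omega)).trans (h k hn)
  have h0 : g (natPt n 0) = 0 := by
    have := hodd (natPt n 0)
    rw [neg_natPt_zero] at this
    omega
  have hpos : ∀ x y : SignedInterval n, 0 ≤ x.1 → x < y → g x < g y := by
    intro x y hx hxy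
    have hxy' : x.1 < y.1 := hxy
    have hy := y.bounds
    rw [x.eq_natPt hx, y.eq_natPt (by omega)]
    exact hlt _ _ (by omega) (by omega)
  intro x y hxy
  have hxy' : x.1 < y.1 := hxy
  rcases le_or_gt 0 x.1 with hx | hx
  · exact hpos x y hx hxy
  rcases le_or_gt y.1 0 with hy | hy
  · have := hpos y.neg x.neg (by simpa using hy) (neg_lt_neg hxy)
    rw [hodd, hodd] at this
    omega
  · have hz : (natPt n 0).1 = 0 := val_natPt (Nat.zero_le n)
    have h1 := hpos (natPt n 0) y hz.ge (show (natPt n 0).1 < y.1 by omega)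
    have h2 := hpos (natPt n 0) x.neg hz.ge
      (show (natPt n 0).1 < x.neg.1 by rw [val_neg]; omega)
    rw [hodd] at h2
    omega

namespace SignedPerm

variable {n : ℕ}

theorem app_natCast (π : SignedPerm n) {m : ℕ} (h : m ≤ n) :
    app π m = (π.1 (natPt n m)).1 := by
  have hm : (m : ℤ) ∈ Finset.Icc (-(n : ℤ)) n := Finset.mem_Icc.2 (by omega)
  unfold app
  rw [dif_pos hm]
  congr 2
  exact Subtype.ext (SignedInterval.val_natPt h).symm

/-- The step from position `m` to position `m + 1` is a descent. -/
def Descent (π : SignedPerm n) (m : ℕ) : Prop := app π (m + 1) < app π m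

theorem app_zero (π : SignedPerm n) : app π 0 = 0 := by
  have h := π.2 (natPt n 0)
  rw [SignedInterval.neg_natPt_zero] at h
  have h' := congrArg Subtype.val h
  rw [SignedInterval.val_neg] at h'
  have := SignedPerm.app_natCast π (Nat.zero_le n)
  push_cast at this
  omega

theorem app_succ_ne (π : SignedPerm n) {m : ℕ} (h : m < n) : app π (m + 1) ≠ app π m := by
  have h1 := SignedPerm.app_natCast π (m := m + 1) h
  push_cast at h1
  rw [h1, SignedPerm.app_natCast π h.le]
  intro he
  exact (SignedInterval.natPt_lt (Nat.lt_succ_self m) h).ne (π.1.injective (Subtype.ext he)).symm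

end SignedPerm

namespace OddMap

variable {n k : ℕ}

theorem val_apply_zero (w : OddMap n k) (π : SignedPerm n) : w.val (π.1 (natPt n 0)) = 0 := by
  have h := π.2 (natPt n 0)
  rw [SignedInterval.neg_natPt_zero] at h
  have h' := w.val_neg (π.1 (natPt n 0))
  rw [← h] at h'
  omega

theorem sorts_iff_forall_prec (w : OddMap n k) (π : SignedPerm n) :
    w.Sorts π ↔ ∀ m < n, w.Prec (π.1 (natPt n m)) (π.1 (natPt n (m + 1))) := by
  refine ⟨fun h m hm => h _ _ (SignedInterval.natPt_lt (Nat.lt_succ_self m) hm), fun h => ?_⟩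
  rw [sorts_iff]
  refine SignedInterval.strictMono_of_odd (fun x => ?_) fun m hm => (prec_iff_key_lt ..).1 (h m hm)
  rw [π.2 x, key_neg]

theorem Prec.val_le {w : OddMap n k} {x y : SignedInterval n} (h : w.Prec x y) :
    w.val x ≤ w.val y := by
  rcases h with h | h
  · exact h.le
  · exact h.1.le

theorem Sorts.val_nonneg {w : OddMap n k} {π : SignedPerm n} (h : w.Sorts π) (m : ℕ) :
    0 ≤ w.val (π.1 (natPt n m)) := by
  rw [← w.val_apply_zero π]
  rcases eq_or_ne (natPt n 0) (natPt n m) with he | he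
  · rw [← he]
  · refine (h _ _ (lt_of_le_of_ne ?_ he)).val_le
    change ((min 0 n : ℕ) : ℤ) ≤ (min m n : ℕ)
    omega

theorem prec_iff_chainStep (w : OddMap n k) (π : SignedPerm n) {m b c : ℕ} (hm : m < n)
    (hb : w.val (π.1 (natPt n m)) = b) (hc : w.val (π.1 (natPt n (m + 1))) = c) :
    w.Prec (π.1 (natPt n m)) (π.1 (natPt n (m + 1))) ↔ ChainStep (SignedPerm.Descent π m) b c := by
  have hne := SignedPerm.app_succ_ne π hm
  have h1 := SignedPerm.app_natCast π (m := m + 1) hm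
  have h2 := SignedPerm.app_natCast π hm.le
  push_cast at h1
  unfold Prec ChainStep SignedPerm.Descent
  rw [hb, hc, ← h1, ← h2, Nat.cast_lt, Nat.cast_inj, Int.even_coe_nat]
  refine or_congr_right (and_congr_right ?_)
  rintro rfl
  rw [← Nat.not_even_iff_odd]
  by_cases he : Even b
  · simp only [he, true_and, not_true_eq_false, false_and, or_false, false_iff, not_lt]
    exact ⟨le_of_lt, fun h => lt_of_le_of_ne h hne.symm⟩
  · simp [he]

open Classical in
-- A word sorted by `π` is determined by its letters at `π(0), …, π(n)`, by oddness; these form a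
-- chain starting at `0`.
theorem card_std_eq (n k : ℕ) (π : SignedPerm n) :
    (Finset.univ.filter fun w : OddMap n k => w.std = π).card =
      ∑ c ∈ Finset.range (k + 1), (chains (SignedPerm.Descent π) n c).card := by
  rw [← Finset.card_biUnion]
  · refine Finset.card_bij (fun w _ m => (w.val (π.1 (natPt n m))).toNat) ?_ ?_ ?_
    · intro w hw
      have hs := (std_eq_iff _ _).1 (Finset.mem_filter.1 hw).2
      have hnn := hs.val_nonneg
      refine Finset.mem_biUnion.2 ⟨(w.val (π.1 (natPt n n))).toNat, ?_, ?_⟩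
      · have := (w.bounds (π.1 (natPt n n))).2
        rw [Finset.mem_range]
        omega
      · rw [mem_chains]
        refine ⟨by rw [val_apply_zero]; rfl, fun m hm => ?_, fun m hm => ?_⟩
        · refine (w.prec_iff_chainStep π hm ?_ ?_).1 ((w.sorts_iff_forall_prec π).1 hs m hm)
          · exact (Int.toNat_of_nonneg (hnn m)).symm
          · exact (Int.toNat_of_nonneg (hnn (m + 1))).symm
        · have : natPt n m = natPt n n := Subtype.ext (by simp [natPt, hm])
          rw [this]
    · intro w hw v hv h
      have hsw := ((std_eq_iff _ _).1 (Finset.mem_filter.1 hw).2).val_nonneg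
      have hsv := ((std_eq_iff _ _).1 (Finset.mem_filter.1 hv).2).val_nonneg
      have heq : ∀ m, w.val (π.1 (natPt n m)) = v.val (π.1 (natPt n m)) := fun m => by
        have h1 := congrFun h m
        have h2 := hsw m
        have h3 := hsv m
        omega
      refine ext_val fun x => ?_
      obtain ⟨y, rfl⟩ := π.1.surjective x
      rcases le_total 0 y.1 with hy | hy
      · rw [y.eq_natPt hy, heq]
      · rw [y.eq_neg_natPt hy, π.2, val_neg, val_neg, heq]
    · intro a ha
      obtain ⟨c, hc, ha⟩ := Finset.mem_biUnion.1 ha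
      obtain ⟨h0, hs, hl⟩ := (mem_chains ..).1 ha
      have hmono : Monotone a := monotone_nat_of_le_succ fun m => by
        rcases lt_or_ge m n with hm | hm
        · exact (hs m hm).le
        · rw [hl m hm, hl (m + 1) (by omega)]
      have hle : ∀ m, a m ≤ k := fun m => by
        have h1 := hmono (le_max_left m n)
        rw [hl _ (le_max_right m n)] at h1
        have := Finset.mem_range.1 hc
        omega
      -- The odd extension of `a`, transported along `π`; the sign vanishes at `0`, in agreement
      -- with `a 0 = 0`.
      let w : OddMap n k := ofFun
        (fun x => (π⁻¹.1 x).1.sign * a (π⁻¹.1 x).1.natAbs)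
        (fun x => by rw [inv_apply_neg, SignedInterval.val_neg, Int.sign_neg, Int.natAbs_neg]; ring)
        (fun x => by
          have := hle (π⁻¹.1 x).1.natAbs
          rcases lt_trichotomy (π⁻¹.1 x).1 0 with h | h | h
          · rw [Int.sign_eq_neg_one_of_neg h]; omega
          · rw [h]; simp
          · rw [Int.sign_eq_one_of_pos h]; omega)
      have hval : ∀ m, w.val (π.1 (natPt n m)) = a m := fun m => by
        have hinv : π⁻¹.1 (π.1 (natPt n m)) = natPt n m := Equiv.symm_apply_apply π.1 _
        simp only [w, val_ofFun, hinv]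
        have hmin : a (min m n) = a m := by
          rcases le_total m n with h | h
          · rw [min_eq_left h]
          · rw [min_eq_right h, hl m h, hl n le_rfl]
        change ((min m n : ℕ) : ℤ).sign * (a (min m n) : ℤ) = _
        rw [hmin]
        rcases Nat.eq_zero_or_pos (min m n) with h | h
        · rw [h] at hmin ⊢
          rw [← hmin, h0]
          rfl
        · rw [Int.sign_eq_one_of_pos (by exact_mod_cast h), one_mul]
      refine ⟨w, Finset.mem_filter.2 ⟨Finset.mem_univ _, ?_⟩, funext fun m => ?_⟩
      · rw [std_eq_iff, sorts_iff_forall_prec]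
        exact fun m hm => (w.prec_iff_chainStep π hm (hval m) (hval (m + 1))).2 (hs m hm)
      · simp only [hval, Int.toNat_natCast]
  · intro c _ c' _ hcc
    refine Finset.disjoint_left.2 fun a ha ha' => hcc ?_
    rw [← ((mem_chains ..).1 ha).2.2 n le_rfl, ((mem_chains ..).1 ha').2.2 n le_rfl]

end OddMap


/-! ### Generating functions of chain counts -/

open PowerSeries in
theorem one_sub_X_mul_eq_iff {F H : ℚ⟦X⟧} :
    (1 - X) * F = H ↔ coeff 0 F = coeff 0 H ∧
      ∀ K, coeff (K + 1) F - coeff K F = coeff (K + 1) H := by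
  rw [PowerSeries.ext_iff]
  refine ⟨fun h => ⟨by simpa [sub_mul] using h 0, fun K => ?_⟩, fun h K => ?_⟩
  · simpa [sub_mul, coeff_succ_X_mul] using h (K + 1)
  · cases K with
    | zero => simpa [sub_mul] using h.1
    | succ K => simpa [sub_mul, coeff_succ_X_mul] using h.2 K

open PowerSeries in
/-- Generating function of the numbers of chains with last letter at most `2K`. -/
noncomputable def evenChainSeries (d : ℕ → Prop) (i : ℕ) : ℚ⟦X⟧ :=
  mk fun K => ∑ a ∈ Finset.range (2 * K + 1), ((chains d i a).card : ℚ)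

open PowerSeries in
/-- Generating function of the numbers of chains with last letter at most `2K + 1`. -/
noncomputable def oddChainSeries (d : ℕ → Prop) (i : ℕ) : ℚ⟦X⟧ :=
  mk fun K => ∑ a ∈ Finset.range (2 * K + 2), ((chains d i a).card : ℚ)

section

open PowerSeries

variable (d : ℕ → Prop) (i : ℕ)

/-- After an ascent, chains ending at `2e` (equality allowed) and at `2e + 1` (strict) both have an
arbitrary previous letter `≤ 2e`. After a descent the letters `2e + 1` and `2e + 2` pair up in the
same way, with bound `2e + 1`. Hence the two series. -/
theorem card_chains_even_of_not (h : ¬ d i) (e : ℕ) :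
    ((chains d (i + 1) (2 * e)).card : ℚ) = coeff e (evenChainSeries d i) := by
  rw [card_chains_succ, evenChainSeries, coeff_mk, Finset.sum_range_succ]
  simp [h]

theorem card_chains_odd_of_not (h : ¬ d i) (e : ℕ) :
    ((chains d (i + 1) (2 * e + 1)).card : ℚ) = coeff e (evenChainSeries d i) := by
  rw [card_chains_succ, evenChainSeries, coeff_mk]
  simp [h]

theorem card_chains_odd_of (h : d i) (e : ℕ) :
    ((chains d (i + 1) (2 * e + 1)).card : ℚ) = coeff e (oddChainSeries d i) := by
  rw [card_chains_succ, oddChainSeries, coeff_mk, Finset.sum_range_succ _ (2 * e + 1)]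
  simp [h]

theorem card_chains_even_of (h : d i) (e : ℕ) :
    ((chains d (i + 1) (2 * e + 2)).card : ℚ) = coeff e (oddChainSeries d i) := by
  have : ¬ Odd (2 * e + 2) := by rw [Nat.not_odd_iff_even]; exact ⟨e + 1, by ring⟩
  rw [card_chains_succ, oddChainSeries, coeff_mk]
  simp [h, this]

theorem card_chains_zero_of (h : d i) : (chains d (i + 1) 0).card = 0 := by
  rw [card_chains_succ]
  simp [h]

theorem coeff_evenChainSeries_succ_sub (K : ℕ) :
    coeff (K + 1) (evenChainSeries d i) - coeff K (evenChainSeries d i) =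
      (chains d i (2 * K + 1)).card + (chains d i (2 * K + 2)).card := by
  rw [evenChainSeries, coeff_mk, coeff_mk, show 2 * (K + 1) + 1 = 2 * K + 1 + 1 + 1 by ring,
    Finset.sum_range_succ _ (2 * K + 1 + 1), Finset.sum_range_succ _ (2 * K + 1)]
  ring

theorem coeff_oddChainSeries_succ_sub (K : ℕ) :
    coeff (K + 1) (oddChainSeries d i) - coeff K (oddChainSeries d i) =
      (chains d i (2 * K + 2)).card + (chains d i (2 * K + 3)).card := by
  rw [oddChainSeries, coeff_mk, coeff_mk, show 2 * (K + 1) + 2 = 2 * K + 2 + 1 + 1 by ring,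
    Finset.sum_range_succ _ (2 * K + 2 + 1), Finset.sum_range_succ _ (2 * K + 2)]
  ring

theorem coeff_zero_evenChainSeries :
    coeff 0 (evenChainSeries d i) = (chains d i 0).card := by
  simp [evenChainSeries]

theorem coeff_zero_oddChainSeries :
    coeff 0 (oddChainSeries d i) = (chains d i 0).card + (chains d i 1).card := by
  rw [oddChainSeries, coeff_mk]
  simp [Finset.sum_range_succ]

/-- Multiplying by `1 - X` takes differences, leaving the two newly admitted last letters. The
factor is `1 + X` when they lie in different pairs, and `2` or `2X` when they form one pair. -/
theorem evenChainSeries_succ_of_not (h : ¬ d i) :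
    (1 - X) * evenChainSeries d (i + 1) = (1 + X) * evenChainSeries d i := by
  rw [one_sub_X_mul_eq_iff]
  refine ⟨?_, fun K => ?_⟩
  · rw [coeff_zero_evenChainSeries, ← mul_zero 2, card_chains_even_of_not d i h]
    simp
  · rw [coeff_evenChainSeries_succ_sub, card_chains_odd_of_not d i h,
      show 2 * K + 2 = 2 * (K + 1) by ring, card_chains_even_of_not d i h, add_mul, one_mul,
      map_add, coeff_succ_X_mul]
    ring

theorem oddChainSeries_succ_of_not (h : ¬ d i) :
    (1 - X) * oddChainSeries d (i + 1) = 2 * evenChainSeries d i := by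
  rw [one_sub_X_mul_eq_iff, two_mul]
  refine ⟨?_, fun K => ?_⟩
  · rw [coeff_zero_oddChainSeries]
    have h0 := card_chains_even_of_not d i h 0
    have h1 := card_chains_odd_of_not d i h 0
    rw [mul_zero] at h0 h1
    rw [h0, h1, map_add]
  · rw [coeff_oddChainSeries_succ_sub, show 2 * K + 2 = 2 * (K + 1) by ring,
      show 2 * K + 3 = 2 * (K + 1) + 1 by ring, card_chains_odd_of_not d i h,
      card_chains_even_of_not d i h, map_add]

theorem evenChainSeries_succ_of (h : d i) :
    (1 - X) * evenChainSeries d (i + 1) = X * (2 * oddChainSeries d i) := by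
  rw [one_sub_X_mul_eq_iff, two_mul]
  refine ⟨?_, fun K => ?_⟩
  · rw [coeff_zero_evenChainSeries, card_chains_zero_of d i h, coeff_zero_X_mul]
    simp
  · rw [coeff_evenChainSeries_succ_sub, card_chains_odd_of d i h, card_chains_even_of d i h,
      coeff_succ_X_mul, map_add]

theorem oddChainSeries_succ_of (h : d i) :
    (1 - X) * oddChainSeries d (i + 1) = (1 + X) * oddChainSeries d i := by
  rw [one_sub_X_mul_eq_iff]
  refine ⟨?_, fun K => ?_⟩
  · rw [coeff_zero_oddChainSeries, card_chains_zero_of d i h]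
    have h1 := card_chains_odd_of d i h 0
    rw [mul_zero] at h1
    rw [h1]
    simp
  · rw [coeff_oddChainSeries_succ_sub, card_chains_even_of d i h,
      show 2 * K + 3 = 2 * (K + 1) + 1 by ring, card_chains_odd_of d i h, add_mul, one_mul,
      map_add, coeff_succ_X_mul]
    ring

theorem evenChainSeries_zero : (1 - X) * evenChainSeries d 0 = 1 := by
  rw [one_sub_X_mul_eq_iff]
  refine ⟨?_, fun K => ?_⟩
  · simp [coeff_zero_evenChainSeries, card_chains_zero]
  · rw [coeff_evenChainSeries_succ_sub]
    simp [card_chains_zero, coeff_one]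

theorem oddChainSeries_zero : (1 - X) * oddChainSeries d 0 = 1 := by
  rw [one_sub_X_mul_eq_iff]
  refine ⟨?_, fun K => ?_⟩
  · simp [coeff_zero_oddChainSeries, card_chains_zero]
  · rw [coeff_oddChainSeries_succ_sub]
    simp [card_chains_zero, coeff_one]

end

/-! ### Peak types and numerator polynomials -/

open Classical in
/-- Twice the number of peaks of a sequence of directions of length `i`, plus one if the first
direction is a descent. -/
noncomputable def peakType (d : ℕ → Prop) (i : ℕ) : ℕ :=
  2 * ((Finset.range (i - 1)).filter fun m => ¬ d m ∧ d (m + 1)).card +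
    if 0 < i ∧ d 0 then 1 else 0

open Classical in
theorem peakType_one (d : ℕ → Prop) : peakType d 1 = if d 0 then 1 else 0 := by
  simp [peakType]

open Classical in
theorem peakType_add_two (d : ℕ → Prop) (i : ℕ) :
    peakType d (i + 2) = peakType d (i + 1) + if ¬ d i ∧ d (i + 1) then 2 else 0 := by
  unfold peakType
  rw [show i + 2 - 1 = i + 1 by omega, show i + 1 - 1 = i by omega, Finset.range_add_one,
    Finset.filter_insert]
  by_cases h : ¬ d i ∧ d (i + 1)
  · rw [if_pos h, if_pos h, Finset.card_insert_of_notMem (by simp)]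
    simp
    ring
  · rw [if_neg h, if_neg h]
    simp

open Polynomial in
/-- The numerator of the generating function for permutations of length `i` and type `j`. -/
noncomputable def peakPoly (i j : ℕ) : ℚ[X] := 2 ^ j * X ^ ((j + 1) / 2) * (1 + X) ^ (i - j)

open Polynomial in
theorem peakPoly_succ {i j : ℕ} (h : j ≤ i) : peakPoly (i + 1) j = (1 + X) * peakPoly i j := by
  rw [peakPoly, peakPoly, Nat.succ_sub h, pow_succ]
  ring

open Polynomial in
theorem peakPoly_add_two_add_two (i j : ℕ) :
    peakPoly (i + 2) (j + 2) = 4 * X * peakPoly i j := by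
  rw [peakPoly, peakPoly, show i + 2 - (j + 2) = i - j by omega,
    show (j + 2 + 1) / 2 = (j + 1) / 2 + 1 by omega]
  ring

open Polynomial in
-- In degree `n + 1` every term but the last is divisible by `1 + X`: evaluation at `-1` isolates
-- the last coefficient, and cancelling `1 + X` leads back to `n`.
theorem eq_zero_of_sum_peakPoly_eq_zero (n : ℕ) (a : ℕ → ℚ)
    (h : ∑ j ∈ Finset.range (n + 1), C (a j) * peakPoly n j = 0) : ∀ j ≤ n, a j = 0 := by
  induction n with
  | zero =>
    intro j hj
    obtain rfl : j = 0 := by omega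
    simpa [peakPoly] using h
  | succ n ih =>
    have hrest : ∑ j ∈ Finset.range (n + 1), C (a j) * peakPoly (n + 1) j =
        (1 + X) * ∑ j ∈ Finset.range (n + 1), C (a j) * peakPoly n j := by
      rw [Finset.mul_sum]
      refine Finset.sum_congr rfl fun j hj => ?_
      rw [peakPoly_succ (Nat.lt_succ_iff.1 (Finset.mem_range.1 hj))]
      ring
    rw [Finset.sum_range_succ, hrest] at h
    have hlast : a (n + 1) = 0 := by
      have := congrArg (eval (-1)) h
      simpa [peakPoly] using this
    rw [hlast, C_0, zero_mul, add_zero] at h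
    have hne : (1 + X : ℚ[X]) ≠ 0 := by
      intro h0
      simpa using congrArg (eval 0) h0
    have := ih ((mul_eq_zero.1 h).resolve_left hne)
    intro j hj
    rcases Nat.le_succ_iff.1 hj with h' | rfl
    · exact this j h'
    · exact hlast

/-- An ascent followed by a descent multiplies the even series by `4X / (1 - X)²`, an initial
descent contributes `2X`, and every other step a factor `1 + X` over `1 - X`. The odd series is
carried along because a descent reads it; after a descent it is known only up to the factor `2X`,
which avoids division by `X`. The bound `≤ i` after an ascent leaves room for the next peak. -/
theorem chainSeries_spec (d : ℕ → Prop) (i : ℕ) :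
    peakType d (i + 1) ≤ i + 1 ∧
    (1 - PowerSeries.X) ^ (i + 2) * evenChainSeries d (i + 1) =
      (peakPoly (i + 1) (peakType d (i + 1)) : PowerSeries ℚ) ∧
    (d i → PowerSeries.X * (2 * ((1 - PowerSeries.X) ^ (i + 2) * oddChainSeries d (i + 1))) =
      (1 + PowerSeries.X) * (peakPoly (i + 1) (peakType d (i + 1)) : PowerSeries ℚ)) ∧
    (¬ d i → peakType d (i + 1) ≤ i ∧
      (1 - PowerSeries.X) ^ (i + 2) * oddChainSeries d (i + 1) =
        2 * (peakPoly i (peakType d (i + 1)) : PowerSeries ℚ)) := by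
  have hsplit : ∀ (F : PowerSeries ℚ) (m : ℕ),
      (1 - PowerSeries.X) ^ (m + 1) * F = (1 - PowerSeries.X) ^ m * ((1 - PowerSeries.X) * F) :=
    fun F m => by ring
  have hcoe : ((2 : Polynomial ℚ) : PowerSeries ℚ) = 2 := by
    rw [← one_add_one_eq_two, Polynomial.coe_add, Polynomial.coe_one, one_add_one_eq_two]
  have hcoe4 : ((4 : Polynomial ℚ) : PowerSeries ℚ) = 4 := by
    rw [show (4 : Polynomial ℚ) = 2 * 2 by norm_num, Polynomial.coe_mul, hcoe]
    norm_num
  induction i with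
  | zero =>
    rw [zero_add, peakType_one, hsplit (evenChainSeries d 1), hsplit (oddChainSeries d 1)]
    by_cases h : d 0
    · rw [evenChainSeries_succ_of d 0 h, oddChainSeries_succ_of d 0 h]
      have h0 := oddChainSeries_zero d
      simp only [h, if_true, true_implies, not_true_eq_false, false_implies, and_true,
        le_refl, true_and, peakPoly]
      norm_num
      rw [hcoe]
      constructor
      · linear_combination 2 * PowerSeries.X * h0
      · linear_combination 2 * PowerSeries.X * (1 + PowerSeries.X) * h0
    · rw [evenChainSeries_succ_of_not d 0 h, oddChainSeries_succ_of_not d 0 h]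
      have h0 := evenChainSeries_zero d
      simp [h, peakPoly]
      constructor
      · linear_combination (1 + PowerSeries.X) * h0
      · linear_combination 2 * h0
  | succ i ih =>
    obtain ⟨hle, hE, hD, hA⟩ := ih
    rw [peakType_add_two, hsplit (evenChainSeries d (i + 1 + 1)),
      hsplit (oddChainSeries d (i + 1 + 1))]
    generalize peakType d (i + 1) = j at *
    by_cases h : d (i + 1)
    · rw [evenChainSeries_succ_of d _ h, oddChainSeries_succ_of d _ h]
      by_cases h' : d i
      · have hD := hD h'
        simp only [h, h', not_true_eq_false, if_false, add_zero, true_implies,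
          false_implies, and_true]
        rw [peakPoly_succ hle]
        simp only [Polynomial.coe_mul, Polynomial.coe_add, Polynomial.coe_one, Polynomial.coe_X]
        refine ⟨by omega, ?_, ?_⟩
        · linear_combination hD
        · linear_combination (1 + PowerSeries.X) * hD
      · obtain ⟨hji, hA⟩ := hA h'
        simp only [h, h', not_true_eq_false, not_false_eq_true, if_true, true_implies,
          false_implies, and_true]
        rw [peakPoly_add_two_add_two]
        simp only [Polynomial.coe_mul, Polynomial.coe_X, hcoe4]
        refine ⟨by omega, ?_, ?_⟩
        · linear_combination 2 * PowerSeries.X * hA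
        · linear_combination 2 * PowerSeries.X * (1 + PowerSeries.X) * hA
    · rw [evenChainSeries_succ_of_not d _ h, oddChainSeries_succ_of_not d _ h]
      simp only [h, and_false, if_false, add_zero, false_implies, true_and, not_false_eq_true,
        true_implies]
      rw [peakPoly_succ hle]
      simp only [Polynomial.coe_mul, Polynomial.coe_add, Polynomial.coe_one, Polynomial.coe_X]
      refine ⟨by omega, ?_, hle, ?_⟩
      · linear_combination (1 + PowerSeries.X) * hE
      · linear_combination 2 * hE

/-! ### Peak classes of signed permutations -/

namespace SignedPerm

variable {n : ℕ}

/-- Twice the number of peaks, plus one if `π(1) < 0`. -/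
noncomputable def peakClass (π : SignedPerm n) : ℕ := peakType (Descent π) n

/-- An ascent at step `m` followed by a descent at step `m + 1` is a peak at position `m + 1`. -/
theorem card_peakSet (π : SignedPerm n) [DecidablePred (Descent π)] :
    ((Finset.range (n - 1)).filter fun m => ¬ Descent π m ∧ Descent π (m + 1)).card =
      peakNumber π := by
  have hiff : ∀ m : ℕ, m < n - 1 → ((¬ Descent π m ∧ Descent π (m + 1)) ↔
      app π (((m : ℤ) + 1) - 1) < app π ((m : ℤ) + 1) ∧
        app π (((m : ℤ) + 1) + 1) < app π ((m : ℤ) + 1)) := fun m hm => by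
    have hne := app_succ_ne π (show m < n by omega)
    unfold Descent
    rw [add_sub_cancel_right, not_lt]
    push_cast
    exact and_congr_left fun _ => ⟨fun h => lt_of_le_of_ne h hne.symm, le_of_lt⟩
  refine Finset.card_bij (fun m _ => (m : ℤ) + 1) (fun m hm => ?_) (fun m _ m' _ h => ?_)
    fun i hi => ?_
  · rw [Finset.mem_filter, Finset.mem_range] at hm
    exact Finset.mem_filter.2 ⟨Finset.mem_Icc.2 (by omega), (hiff m hm.1).1 hm.2⟩
  · simpa using h
  · obtain ⟨hi, hi'⟩ := Finset.mem_filter.1 hi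
    rw [Finset.mem_Icc] at hi
    have hcast : ((i - 1).toNat : ℤ) + 1 = i := by omega
    refine ⟨(i - 1).toNat, ?_, hcast⟩
    have hlt : (i - 1).toNat < n - 1 := by omega
    rw [Finset.mem_filter, Finset.mem_range, hiff _ hlt, hcast]
    exact ⟨hlt, hi'⟩

theorem peakClass_eq (π : SignedPerm n) (hn : 1 ≤ n) :
    peakClass π = 2 * peakNumber π + if app π 1 < 0 then 1 else 0 := by
  classical
  have h0 : Descent π 0 ↔ app π 1 < 0 := by
    unfold Descent
    rw [Nat.cast_zero, zero_add, app_zero]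
  rw [peakClass, peakType, ← card_peakSet]
  simp only [show 0 < n by omega, true_and, h0]

theorem peakClass_le (π : SignedPerm n) : peakClass π ≤ n := by
  cases n with
  | zero => simp [peakClass, peakType]
  | succ n => exact (chainSeries_spec _ n).1

theorem app_one_ne_zero (π : SignedPerm n) (hn : 1 ≤ n) : app π 1 ≠ 0 := by
  have := app_succ_ne π (m := 0) hn
  rwa [Nat.cast_zero, zero_add, app_zero] at this

open SignedInterval (natPt)

open Classical in
/-- A signed permutation with prescribed descents, obtained by changing signs of the identity. -/
theorem exists_descent_iff (n : ℕ) (d : ℕ → Prop) :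
    ∃ π : SignedPerm n, ∀ m < n, Descent π m ↔ d m := by
  -- Absolute values increase along the positions, so the sign of the value at `m + 1` alone decides
  -- step `m`. At `0` the truncated subtraction is harmless, as `0` is its own negative.
  let s : SignedInterval n → SignedInterval n := fun x => if d (x.1.natAbs - 1) then x.neg else x
  have hs : ∀ x, s (s x) = x := fun x => by
    simp only [s]
    split_ifs <;> simp_all
  let π : SignedPerm n := ⟨⟨s, s, hs, hs⟩, fun x => by
    change s x.neg = (s x).neg
    simp only [s, SignedInterval.val_neg, Int.natAbs_neg]
    split_ifs <;> rfl⟩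
  have happ : ∀ m ≤ n, app π m = if d (m - 1) then -(m : ℤ) else m := fun m hm => by
    rw [app_natCast π hm]
    change (s (natPt n m)).1 = _
    have hv := SignedInterval.val_natPt hm
    have habs : (natPt n m).1.natAbs = m := by rw [hv]; rfl
    simp only [s, habs]
    split_ifs
    · rw [SignedInterval.val_neg, hv]
    · exact hv
  refine ⟨π, fun m hm => ?_⟩
  have h1 := happ (m + 1) hm
  have h2 := happ m hm.le
  rw [Nat.add_sub_cancel] at h1
  push_cast at h1
  unfold Descent
  rw [h1, h2]
  split_ifs with h3 h4 h4 <;> simp only [h3, iff_true, iff_false] <;> omega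

end SignedPerm

theorem peakType_congr {d d' : ℕ → Prop} {i : ℕ} (h : ∀ m < i, d m ↔ d' m) :
    peakType d i = peakType d' i := by
  classical
  unfold peakType
  congr 1
  · congr 2
    ext m
    simp only [Finset.mem_filter, Finset.mem_range]
    refine and_congr_right fun hm => ?_
    rw [h m (by omega), h (m + 1) (by omega)]
  · rcases Nat.eq_zero_or_pos i with rfl | hi
    · simp
    · simp only [h 0 hi]

/-- The directions that alternate and end with a descent at step `j`, followed by ascents. -/
theorem peakType_alternating (j i : ℕ) :
    peakType (fun m => m < j ∧ (j - m) % 2 = 1) (i + 1) =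
      if j ≤ i + 1 then j else if (j - i) % 2 = 1 then i + 1 else i := by
  classical
  induction i with
  | zero =>
    rw [peakType_one]
    split_ifs <;> omega
  | succ i ih =>
    rw [peakType_add_two, ih]
    split_ifs <;> omega

open SignedPerm

/-! ### The peak span and the algebra structure -/

/-- The sum of all signed permutations of peak class `j`. -/
noncomputable def peakClassSum (n j : ℕ) : MonoidAlgebra ℚ (SignedPerm n) :=
  ∑ π : SignedPerm n with peakClass π = j, MonoidAlgebra.of ℚ (SignedPerm n) π

theorem peakSumPos_eq {n : ℕ} (hn : 1 ≤ n) (p : ℕ) :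
    peakSumPos n p = peakClassSum n (2 * p) := by
  unfold peakSumPos peakClassSum
  refine Finset.sum_congr (Finset.filter_congr fun π _ => ?_) fun _ _ => rfl
  have := app_one_ne_zero π hn
  rw [peakClass_eq π hn]
  split_ifs <;> omega

theorem peakSumNeg_eq {n : ℕ} (hn : 1 ≤ n) (p : ℕ) :
    peakSumNeg n p = peakClassSum n (2 * p + 1) := by
  unfold peakSumNeg peakClassSum
  refine Finset.sum_congr (Finset.filter_congr fun π _ => ?_) fun _ _ => rfl
  have := app_one_ne_zero π hn
  rw [peakClass_eq π hn]
  split_ifs <;> omega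

theorem peakClassSum_eq_zero {n j : ℕ} (h : n < j) : peakClassSum n j = 0 := by
  unfold peakClassSum
  rw [Finset.filter_false_of_mem, Finset.sum_empty]
  intro π _
  have := peakClass_le π
  omega

/-- The linear combinations of the peak class sums. -/
noncomputable def peakComb (n : ℕ) : (Fin (n + 1) → ℚ) →ₗ[ℚ] MonoidAlgebra ℚ (SignedPerm n) :=
  Fintype.linearCombination ℚ fun j : Fin (n + 1) => peakClassSum n j

theorem peakSpanB_eq_range {n : ℕ} (hn : 1 ≤ n) :
    peakSpanB n = LinearMap.range (peakComb n) := by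
  rw [peakComb, Fintype.range_linearCombination, peakSpanB]
  have hmem : ∀ j, peakClassSum n j ∈
      Submodule.span ℚ (Set.range fun j : Fin (n + 1) => peakClassSum n j) := fun j => by
    rcases Nat.lt_or_ge n j with h | h
    · rw [peakClassSum_eq_zero h]
      exact Submodule.zero_mem _
    · exact Submodule.subset_span ⟨⟨j, Nat.lt_succ_of_le h⟩, rfl⟩
  apply le_antisymm
  · rw [Submodule.span_le]
    rintro _ (⟨p, rfl⟩ | ⟨p, rfl⟩)
    · rw [peakSumPos_eq hn]
      exact hmem _
    · rw [peakSumNeg_eq hn]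
      exact hmem _
  · refine Submodule.span_le.2 ?_
    rintro _ ⟨j, rfl⟩
    apply Submodule.subset_span
    rcases Nat.even_or_odd' j.1 with ⟨p, hp | hp⟩
    · exact Or.inl ⟨p, by simp only [hp, peakSumPos_eq hn]⟩
    · exact Or.inr ⟨p, by simp only [hp, peakSumNeg_eq hn]⟩

/-- The peak class as an element of `Fin (n + 1)`. -/
noncomputable def SignedPerm.peakClassFin {n : ℕ} (π : SignedPerm n) : Fin (n + 1) :=
  ⟨peakClass π, Nat.lt_succ_of_le (peakClass_le π)⟩

theorem peakComb_apply (n : ℕ) (a : Fin (n + 1) → ℚ) :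
    peakComb n a = ∑ π : SignedPerm n, a (peakClassFin π) • MonoidAlgebra.of ℚ (SignedPerm n) π := by
  rw [peakComb, Fintype.linearCombination_apply, ← Finset.sum_fiberwise Finset.univ peakClassFin]
  refine Finset.sum_congr rfl fun j _ => ?_
  rw [peakClassSum, Finset.smul_sum]
  refine Finset.sum_congr (Finset.filter_congr fun π _ => ?_) fun π hπ => ?_
  · rw [Fin.ext_iff]
    rfl
  · rw [(Finset.mem_filter.1 hπ).2]

theorem coeff_peakComb (n : ℕ) (a : Fin (n + 1) → ℚ) (π : SignedPerm n) :
    (peakComb n a).coeff π = a (peakClassFin π) := by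
  classical
  rw [peakComb_apply]
  simp [MonoidAlgebra.coeff_sum, Finsupp.single_apply]

/-- Each class `j ≤ n` contains a permutation whose steps alternate up to a descent at step `j - 1`
and then ascend, and the coefficient there is `a j`. -/
theorem peakComb_injective (n : ℕ) : Function.Injective (peakComb n) := by
  intro a b h
  funext j
  obtain ⟨π, hπ⟩ : ∃ π : SignedPerm n, peakClassFin π = j := by
    obtain ⟨π, hπ⟩ := exists_descent_iff n fun m => m < j.1 ∧ (j.1 - m) % 2 = 1
    refine ⟨π, Fin.ext ?_⟩
    change peakType _ n = _
    rw [peakType_congr hπ]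
    have hj := j.2
    cases n with
    | zero =>
      simp [peakType]
    | succ n => rw [peakType_alternating, if_pos (Nat.lt_succ_iff.1 hj)]
  rw [← hπ, ← coeff_peakComb n a, h, coeff_peakComb]

open PowerSeries in
/-- The generating function of the coefficients of the sums `stdSum n (2K)` at class `j`. -/
noncomputable def peakSeries (n j : ℕ) : ℚ⟦X⟧ := ((1 - X) ^ (n + 1))⁻¹ * (peakPoly n j : ℚ⟦X⟧)

open PowerSeries in
theorem mul_peakSeries (n j : ℕ) :
    (1 - X) ^ (n + 1) * peakSeries n j = (peakPoly n j : ℚ⟦X⟧) := by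
  rw [peakSeries, ← mul_assoc, PowerSeries.mul_inv_cancel _ (by simp), one_mul]

open PowerSeries in
theorem evenChainSeries_eq_peakSeries {n : ℕ} (hn : 1 ≤ n) (π : SignedPerm n) :
    evenChainSeries (Descent π) n = peakSeries n (peakClass π) := by
  have h : (1 - X : ℚ⟦X⟧) ^ (n + 1) ≠ 0 := pow_ne_zero _ fun h => by
    simpa using congrArg (coeff 0) h
  apply mul_left_cancel₀ h
  rw [mul_peakSeries]
  obtain ⟨m, rfl⟩ := Nat.exists_eq_add_of_le' hn
  exact (chainSeries_spec _ m).2.1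

theorem stdSum_eq_peakComb {n : ℕ} (hn : 1 ≤ n) (K : ℕ) :
    OddMap.stdSum n (2 * K) =
      peakComb n fun j => PowerSeries.coeff K (peakSeries n j) := by
  classical
  rw [peakComb_apply, OddMap.stdSum, ← Finset.sum_fiberwise Finset.univ OddMap.std]
  refine Finset.sum_congr rfl fun π _ => ?_
  have hcard := OddMap.card_std_eq n (2 * K) π
  have hcoeff : PowerSeries.coeff K (peakSeries n (peakClass π)) =
      (Finset.univ.filter fun w : OddMap n (2 * K) => w.std = π).card := by
    rw [← evenChainSeries_eq_peakSeries hn, evenChainSeries, PowerSeries.coeff_mk]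
    rw [← Nat.cast_sum, Nat.cast_inj, ← hcard]
  change _ = PowerSeries.coeff K (peakSeries n (peakClass π)) • _
  rw [hcoeff, Finset.sum_congr rfl fun w hw => by rw [(Finset.mem_filter.1 hw).2],
    Finset.sum_const, Nat.cast_smul_eq_nsmul]

/-- By duality: a functional vanishing on all these vectors is a linear relation among the series,
hence among their numerators, hence zero. -/
theorem span_coeff_peakSeries (n : ℕ) :
    Submodule.span ℚ (Set.range fun (K : ℕ) (j : Fin (n + 1)) =>
      PowerSeries.coeff K (peakSeries n j)) = ⊤ := by
  classical
  by_contra hne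
  obtain ⟨f, hf, hker⟩ := Submodule.exists_le_ker_of_lt_top _ (lt_top_iff_ne_top.2 hne)
  let b : ℕ → ℚ := fun j => if h : j < n + 1 then f (Pi.single ⟨j, h⟩ 1) else 0
  have hb : ∀ j : Fin (n + 1), b j = f (Pi.single j 1) := fun j => dif_pos j.2
  have happly : ∀ x, f x = ∑ j : Fin (n + 1), x j * b j := fun x => by
    conv_lhs => rw [pi_eq_sum_univ' x, map_sum]
    refine Finset.sum_congr rfl fun j _ => ?_
    rw [map_smul, hb, smul_eq_mul]
  have hzero : ∑ j : Fin (n + 1), PowerSeries.C (b j) * peakSeries n j = 0 := by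
    ext K
    have hK := hker (Submodule.subset_span ⟨K, rfl⟩)
    rw [LinearMap.mem_ker, happly] at hK
    rw [map_sum, map_zero, ← hK]
    exact Finset.sum_congr rfl fun j _ => by rw [PowerSeries.coeff_C_mul, mul_comm]
  have hpoly : ∑ j ∈ Finset.range (n + 1), Polynomial.C (b j) * peakPoly n j = 0 := by
    rw [← Polynomial.coe_eq_zero_iff, ← Fin.sum_univ_eq_sum_range
      (fun j => Polynomial.C (b j) * peakPoly n j)]
    have h := congrArg ((1 - PowerSeries.X) ^ (n + 1) * ·) hzero
    simp only [mul_zero, Finset.mul_sum] at h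
    rw [← h, ← Polynomial.coeToPowerSeries.ringHom_apply, map_sum]
    refine Finset.sum_congr rfl fun j _ => ?_
    rw [Polynomial.coeToPowerSeries.ringHom_apply, Polynomial.coe_mul, Polynomial.coe_C,
      mul_left_comm, mul_peakSeries]
  refine hf (LinearMap.ext fun x => ?_)
  rw [happly, LinearMap.zero_apply]
  refine Finset.sum_eq_zero fun j _ => ?_
  rw [eq_zero_of_sum_peakPoly_eq_zero n b hpoly j (Nat.lt_succ_iff.1 j.2), mul_zero]

theorem peakSpanB_eq_span_stdSum {n : ℕ} (hn : 1 ≤ n) :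
    peakSpanB n = Submodule.span ℚ (Set.range fun K => OddMap.stdSum n (2 * K)) := by
  rw [peakSpanB_eq_range hn, LinearMap.range_eq_map, ← span_coeff_peakSeries, Submodule.map_span,
    ← Set.range_comp]
  congr 2
  funext K
  exact (stdSum_eq_peakComb hn K).symm

theorem mul_mem_peakSpanB {n : ℕ} (hn : 1 ≤ n) {x y : MonoidAlgebra ℚ (SignedPerm n)}
    (hx : x ∈ peakSpanB n) (hy : y ∈ peakSpanB n) : x * y ∈ peakSpanB n := by
  rw [peakSpanB_eq_span_stdSum hn] at *
  have h := Submodule.mul_mem_mul hx hy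
  rw [Submodule.span_mul_span] at h
  refine Submodule.span_mono ?_ h
  rintro _ ⟨_, ⟨K, rfl⟩, _, ⟨L, rfl⟩, rfl⟩
  -- Even cutoffs are stable: `2(2K)(2L) + 2K + 2L = 2(4KL + K + L)`.
  refine ⟨4 * K * L + K + L, ?_⟩
  simp only [OddMap.stdSum_mul]
  congr 1
  ring

theorem mul_comm_of_mem_peakSpanB {n : ℕ} (hn : 1 ≤ n) {x y : MonoidAlgebra ℚ (SignedPerm n)}
    (hx : x ∈ peakSpanB n) (hy : y ∈ peakSpanB n) : x * y = y * x := by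
  rw [peakSpanB_eq_span_stdSum hn] at hx hy
  induction hx, hy using Submodule.span_induction₂ with
  | mem_mem x y hx hy =>
    obtain ⟨K, rfl⟩ := hx
    obtain ⟨L, rfl⟩ := hy
    simp only [OddMap.stdSum_mul]
    congr 1
    ring
  | zero_left => simp
  | zero_right => simp
  | add_left x y z _ _ _ h₁ h₂ => rw [add_mul, mul_add, h₁, h₂]
  | add_right x y z _ _ _ h₁ h₂ => rw [add_mul, mul_add, h₁, h₂]
  | smul_left r x y _ _ h => rw [smul_mul_assoc, mul_smul_comm, h]
  | smul_right r x y _ _ h => rw [smul_mul_assoc, mul_smul_comm, h]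

theorem one_mem_peakSpanB {n : ℕ} (hn : 1 ≤ n) : 1 ∈ peakSpanB n := by
  rw [peakSpanB_eq_span_stdSum hn, ← OddMap.stdSum_zero]
  exact Submodule.subset_span ⟨0, rfl⟩

theorem mainTheorem9 (n : ℕ) (hn : 1 ≤ n) :
    ∃ A : Subalgebra ℚ (MonoidAlgebra ℚ (SignedPerm n)),
      Subalgebra.toSubmodule A = peakSpanB n ∧
      (∀ x ∈ A, ∀ y ∈ A, x * y = y * x) ∧
      Module.finrank ℚ A = n + 1 := by
  refine ⟨(peakSpanB n).toSubalgebra (one_mem_peakSpanB hn) fun _ _ => mul_mem_peakSpanB hn,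
    Submodule.toSubalgebra_toSubmodule .., fun x hx y hy => mul_comm_of_mem_peakSpanB hn hx hy, ?_⟩
  change Module.finrank ℚ (peakSpanB n) = n + 1
  rw [peakSpanB_eq_range hn, LinearMap.finrank_range_of_inj (peakComb_injective n),
    Module.finrank_fin_fun]
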